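/- Let $n,m$ be nonnegative integers and let $\mathbb{M}_n$ denote the space of complex $n\times n$ matrices. Let $Z\in\mathbb{M}_n$ be a contraction, i.e. $\|Z\|\le 1$ for the operator norm induced by the Euclidean norm on $\mathbb{C}^n$, and let $\Phi:\mathbb{M}_n\to\mathbb{M}_m$ be a positive linear map, i.e. a $\mathbb{C}$-linear map sending positive semidefinite matrices to positive semidefinite matrices. Let $I\in\mathbb{M}_n$ be the identity matrix and write $|X|=(X^*X)^{1/2}$. Then $$|\Phi(Z)|\prec_{w\log}\Phi(I),$$ that is, $|\Phi(Z)|$ and $\Phi(I)$ are positive semidefinite and $$\prod_{j=1}^k\lambda_j(|\Phi(Z)|)\le\prod_{j=1}^k\lambda_j(\Phi(I))\qquad\text{for every } k=1,\ldots,m,$$ where $\lambda_1(A)\ge\cdots\ge\lambda_m(A)$ denote the eigenvalues of a positive semidefinite matrix $A\in\mathbb{M}_m$, counted with multiplicity. -/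

import Mathlib

open scoped ComplexOrder MatrixOrder

/-- A square complex matrix is a contraction if its operator norm, with respect to the Euclidean
norm on vectors, is at most one. -/
def Matrix.IsContraction {ι : Type*} [Fintype ι] [DecidableEq ι] (Z : Matrix ι ι ℂ) : Prop :=
  ‖Matrix.toEuclideanCLM (n := ι) (𝕜 := ℂ) Z‖ ≤ 1

/-- Weak log-majorisation between positive semidefinite matrices `A` and `B` of the same size:
for every `k`, the product of the `k` largest eigenvalues of `A` is at most the product of
the `k` largest eigenvalues of `B`, counted with multiplicity. Here `eigenvalues₀` lists the
eigenvalues in nonincreasing order, starting at index `0`. Positive semidefiniteness of both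
matrices is part of the relation. -/
def Matrix.WeakLogMajorizedBy {ι : Type*} [Fintype ι] [DecidableEq ι] (A B : Matrix ι ι ℂ) :
    Prop :=
  ∃ (hA : A.PosSemidef) (hB : B.PosSemidef), ∀ k : ℕ, 1 ≤ k → k ≤ Fintype.card ι →
    ∏ j with j.val < k, hA.isHermitian.eigenvalues₀ j ≤
      ∏ j with j.val < k, hB.isHermitian.eigenvalues₀ j

/-! Write `B = Φ 1` and `T = Φ Z`. Two facts suffice. (1) The block matrix `[B, T; Tᴴ, B]` is
positive semidefinite. For unitary `Z` it splits along the spectral projections into blocks `[A, zA;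
z̄A, A]` with `|z| = 1`; an invertible contraction is the mean of two unitaries; a perturbation
removes invertibility (`posSemidef_fromBlocks_map`). (2) Such a block forces `|T|` to be weakly
log-majorised by `B` (`PosSemidef.abs_weakLogMajorizedBy`). Let `D` hold the top `k` eigenvalues of
`|T|`, assumed nonzero, and `V` the eigenvectors; `X = T V D⁻¹` is an isometry. Compressing by `X ⊕
V` gives `[P, D; D, VᴴBV] ≥ 0` with `P = XᴴBX`, so `D P⁻¹ D ≤ VᴴBV`. By interlacing, `det P` and
`det (D P⁻¹ D)` are both at most the product of the top `k` eigenvalues of `B`, and they multiply to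
`(det D)²`. -/

namespace Matrix

/-! ### Eigenvalue and determinant bounds for compressions -/

/-- Courant–Fischer in diagonal form: a single vector `x` bounds the two quadratic forms from
opposite sides. -/
theorem le_of_antitone_of_isometry {k m : ℕ} {d : Fin k → ℝ} {e : Fin m → ℝ} (hd : Antitone d)
    (he : Antitone e) {Y : Matrix (Fin m) (Fin k) ℂ} (hY : Yᴴ * Y = 1)
    (h : (Yᴴ * diagonal (fun j => (e j : ℂ)) * Y - diagonal (fun i => (d i : ℂ))).PosSemidef)
    (i : Fin k) (j : Fin m) (hij : i.val = j.val) : d i ≤ e j := by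
  let N : Matrix {b : Fin m // b < j} {a : Fin k // a ≤ i} ℂ := Y.submatrix (↑) (↑)
  have hcard : Fintype.card {b : Fin m // b < j} < Fintype.card {a : Fin k // a ≤ i} := by
    have h1 : Fintype.card {b : Fin m // b < j} = j := by
      rw [Fintype.card_subtype, Finset.filter_gt_eq_Iio, Fin.card_Iio]
    have h2 : Fintype.card {a : Fin k // a ≤ i} = i + 1 := by
      rw [Fintype.card_subtype, Finset.filter_ge_eq_Iic, Fin.card_Iic]
    omega
  -- `N` has `j` rows and `i + 1 = j + 1` columns, so some nonzero `x` supported on indices `≤ i`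
  -- has `Y x` vanishing on indices `< j`.
  obtain ⟨c, hc, hc0⟩ : ∃ c : {a : Fin k // a ≤ i} → ℂ, N *ᵥ c = 0 ∧ c ≠ 0 := by
    have := LinearMap.ker_ne_bot_of_finrank_lt (f := N.mulVecLin) (by simpa using hcard)
    obtain ⟨c, hc, h0⟩ := Submodule.exists_mem_ne_zero_of_ne_bot this
    exact ⟨c, by simpa using hc, h0⟩
  let x : Fin k → ℂ := fun a => if ha : a ≤ i then c ⟨a, ha⟩ else 0
  have hx : ∀ a, ¬ a ≤ i → x a = 0 := fun a ha => by simp [x, ha]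
  have hyx : ∀ b, b < j → (Y *ᵥ x) b = 0 := by
    intro b hb
    have h0 : ∑ a : {a : Fin k // a ≤ i}, Y b a * c a = 0 := congrFun hc ⟨b, hb⟩
    have h1 : ∑ a with a ≤ i, Y b a * x a = ∑ a : {a : Fin k // a ≤ i}, Y b a * x a :=
      Finset.sum_subtype _ (by simp) _
    calc ∑ a, Y b a * x a = ∑ a with a ≤ i, Y b a * x a :=
          (Finset.sum_filter_of_ne fun a _ ha => by
            by_contra hai
            exact ha (by rw [hx a hai, mul_zero])).symm
      _ = 0 := by
          rw [h1, ← h0]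
          exact Finset.sum_congr rfl fun a _ => by simp [x, a.2]
  have hsum : ∑ b, ‖(Y *ᵥ x) b‖ ^ 2 = ∑ a, ‖x a‖ ^ 2 := by
    have : star (Y *ᵥ x) ⬝ᵥ (Y *ᵥ x) = star x ⬝ᵥ x := by
      rw [star_mulVec, ← dotProduct_mulVec, mulVec_mulVec, hY, one_mulVec]
    simp only [dotProduct, Pi.star_apply, RCLike.star_def, RCLike.conj_mul] at this
    exact_mod_cast this
  have hpos : 0 < ∑ a, ‖x a‖ ^ 2 := by
    obtain ⟨a, ha⟩ := Function.ne_iff.mp hc0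
    refine Finset.sum_pos' (fun _ _ => by positivity) ⟨a, Finset.mem_univ _, ?_⟩
    have : x a = c a := by simp [x, a.2]
    rw [this]
    have : 0 < ‖c a‖ := norm_pos_iff.mpr ha
    positivity
  have hq : ∑ a, d a * ‖x a‖ ^ 2 ≤ ∑ b, e b * ‖(Y *ᵥ x) b‖ ^ 2 := by
    have := h.dotProduct_mulVec_nonneg x
    have key : ∀ {n : ℕ} (f : Fin n → ℝ) (z : Fin n → ℂ),
        star z ⬝ᵥ (diagonal (fun j => (f j : ℂ)) *ᵥ z) = ((∑ b, f b * ‖z b‖ ^ 2 : ℝ) : ℂ) := by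
      intro n f z
      simp only [dotProduct, mulVec_diagonal, Pi.star_apply, RCLike.star_def]
      push_cast
      refine Finset.sum_congr rfl fun b _ => ?_
      rw [← Complex.conj_mul']
      ring
    rw [sub_mulVec, dotProduct_sub, key, ← mulVec_mulVec, ← mulVec_mulVec, dotProduct_mulVec,
      ← star_mulVec, key, ← Complex.ofReal_sub, Complex.zero_le_real] at this
    linarith
  have h1 : d i * ∑ a, ‖x a‖ ^ 2 ≤ ∑ a, d a * ‖x a‖ ^ 2 := by
    rw [Finset.mul_sum]
    refine Finset.sum_le_sum fun a _ => ?_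
    by_cases ha : a ≤ i
    · exact mul_le_mul_of_nonneg_right (hd ha) (by positivity)
    · simp [hx a ha]
  have h2 : ∑ b, e b * ‖(Y *ᵥ x) b‖ ^ 2 ≤ e j * ∑ b, ‖(Y *ᵥ x) b‖ ^ 2 := by
    rw [Finset.mul_sum]
    refine Finset.sum_le_sum fun b _ => ?_
    by_cases hb : b < j
    · simp [hyx b hb]
    · exact mul_le_mul_of_nonneg_right (he (not_lt.mp hb)) (by positivity)
  rw [hsum] at h2
  exact le_of_mul_le_mul_right (h1.trans (hq.trans h2)) hpos

theorem IsHermitian.exists_unitary_eigenvalues₀ {ι : Type*} [Fintype ι] [DecidableEq ι]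
    {A : Matrix ι ι ℂ} (hA : A.IsHermitian) :
    ∃ W : Matrix ι (Fin (Fintype.card ι)) ℂ, Wᴴ * W = 1 ∧ W * Wᴴ = 1 ∧
      A = W * diagonal (fun j => (hA.eigenvalues₀ j : ℂ)) * Wᴴ := by
  let σ : Fin (Fintype.card ι) ≃ ι := Fintype.equivOfCardEq (Fintype.card_fin _)
  let U : Matrix ι ι ℂ := hA.eigenvectorUnitary
  have h1 : Uᴴ * U = 1 := (mem_unitaryGroup_iff').1 hA.eigenvectorUnitary.2
  have h2 : U * Uᴴ = 1 := (mem_unitaryGroup_iff).1 hA.eigenvectorUnitary.2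
  have h3 : A = U * diagonal (fun j => (hA.eigenvalues j : ℂ)) * Uᴴ := by
    have := hA.spectral_theorem
    rw [Unitary.conjStarAlgAut_apply] at this
    exact this
  refine ⟨U.submatrix id σ, ?_, ?_, ?_⟩
  · rw [conjTranspose_submatrix, ← submatrix_mul _ _ _ _ _ Function.bijective_id, h1, submatrix_one_equiv]
  · rw [conjTranspose_submatrix, ← submatrix_mul _ _ _ _ _ σ.bijective, h2, submatrix_id_id]
  · have : diagonal (fun j => (hA.eigenvalues₀ j : ℂ)) =
        (diagonal (fun j => (hA.eigenvalues j : ℂ))).submatrix σ σ := by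
      rw [submatrix_diagonal_equiv]
      congr 1
      funext j
      simp [IsHermitian.eigenvalues, σ]
    rw [this, conjTranspose_submatrix, ← submatrix_mul _ _ _ _ _ σ.bijective,
      ← submatrix_mul _ _ _ _ _ σ.bijective, submatrix_id_id, ← h3]

theorem IsHermitian.eigenvalues₀_le_of_isometry {ι κ : Type*} [Fintype ι] [DecidableEq ι]
    [Fintype κ] [DecidableEq κ] {A : Matrix κ κ ℂ} {B : Matrix ι ι ℂ} (hA : A.IsHermitian)
    (hB : B.IsHermitian) {X : Matrix ι κ ℂ} (hX : Xᴴ * X = 1) (h : (Xᴴ * B * X - A).PosSemidef)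
    (i : Fin (Fintype.card κ)) (j : Fin (Fintype.card ι)) (hij : i.val = j.val) :
    hA.eigenvalues₀ i ≤ hB.eigenvalues₀ j := by
  obtain ⟨V, hV1, hV2, hV⟩ := hA.exists_unitary_eigenvalues₀
  obtain ⟨W, hW1, hW2, hW⟩ := hB.exists_unitary_eigenvalues₀
  refine le_of_antitone_of_isometry (Y := Wᴴ * X * V) hA.eigenvalues₀_antitone
    hB.eigenvalues₀_antitone ?_ ?_ i j hij
  · calc (Wᴴ * X * V)ᴴ * (Wᴴ * X * V) = Vᴴ * (Xᴴ * (W * Wᴴ) * X) * V := by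
          simp [Matrix.mul_assoc]
      _ = 1 := by rw [hW2, Matrix.mul_one, hX, Matrix.mul_one, hV1]
  · have := h.conjTranspose_mul_mul_same V
    convert this using 1
    rw [Matrix.mul_sub, Matrix.sub_mul]
    congr 1
    · conv_rhs => rw [hW]
      simp [Matrix.mul_assoc]
    · conv_rhs => rw [hV]
      calc _ = 1 * diagonal (fun i => (hA.eigenvalues₀ i : ℂ)) * 1 := by simp
        _ = _ := by rw [← hV1]; simp only [Matrix.mul_assoc]

theorem IsHermitian.det_eq_prod_eigenvalues₀ {ι : Type*} [Fintype ι] [DecidableEq ι]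
    {A : Matrix ι ι ℂ} (hA : A.IsHermitian) : A.det = ((∏ j, hA.eigenvalues₀ j : ℝ) : ℂ) := by
  rw [hA.det_eq_prod_eigenvalues, Complex.ofReal_prod]
  exact (Equiv.prod_comp (Fintype.equivOfCardEq (Fintype.card_fin _) : _ ≃ ι).symm
    (fun j => (hA.eigenvalues₀ j : ℂ)))

theorem PosSemidef.eigenvalues₀_nonneg {ι : Type*} [Fintype ι] [DecidableEq ι]
    {A : Matrix ι ι ℂ} (hA : A.PosSemidef) (j) : 0 ≤ hA.isHermitian.eigenvalues₀ j := by
  have := hA.eigenvalues_nonneg ((Fintype.equivOfCardEq (Fintype.card_fin _) : _ ≃ ι) j)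
  simpa [IsHermitian.eigenvalues] using this

theorem _root_.Fin.prod_filter_val_lt {M : Type*} [CommMonoid M] {k m : ℕ} (hkm : k ≤ m)
    (f : Fin m → M) : ∏ j with j.val < k, f j = ∏ i : Fin k, f (Fin.castLE hkm i) := by
  symm
  refine Finset.prod_bij (fun i _ => Fin.castLE hkm i) (by simp) (by simp [Fin.ext_iff]) ?_ (by simp)
  intro b hb
  exact ⟨⟨b, by simpa using hb⟩, by simp, rfl⟩

theorem PosSemidef.det_le_prod_eigenvalues₀ {ι : Type*} [Fintype ι] [DecidableEq ι] {k : ℕ}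
    (hk : k ≤ Fintype.card ι) {A : Matrix (Fin k) (Fin k) ℂ} {B : Matrix ι ι ℂ}
    (hA : A.PosSemidef) (hB : B.IsHermitian) {X : Matrix ι (Fin k) ℂ} (hX : Xᴴ * X = 1)
    (h : (Xᴴ * B * X - A).PosSemidef) :
    A.det ≤ ((∏ j with j.val < k, hB.eigenvalues₀ j : ℝ) : ℂ) := by
  rw [hA.isHermitian.det_eq_prod_eigenvalues₀, Complex.real_le_real, Fin.prod_filter_val_lt hk,
    ← Equiv.prod_comp (finCongr (Fintype.card_fin k))
      (fun i => hB.eigenvalues₀ (Fin.castLE hk i))]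
  exact Finset.prod_le_prod (fun i _ => hA.eigenvalues₀_nonneg i) fun i _ =>
    hA.isHermitian.eigenvalues₀_le_of_isometry hB hX h i _ rfl

/-! ### From a positive block matrix to log-majorisation -/

/-- If `u` is isotropic for `P`, then `(u, 0)` is isotropic for the block matrix, hence in its
kernel, which forces `Dᴴ u = 0`. -/
theorem PosSemidef.posDef_of_fromBlocks {κ : Type*} [Fintype κ] [DecidableEq κ]
    {P D Q : Matrix κ κ ℂ} (h : (fromBlocks P D Dᴴ Q).PosSemidef) (hD : IsUnit D) : P.PosDef := by
  have hP : P.PosSemidef := h.submatrix Sum.inl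
  refine .of_dotProduct_mulVec_pos hP.isHermitian fun u hu => ?_
  refine lt_of_le_of_ne (hP.dotProduct_mulVec_nonneg u) fun h0 => hu ?_
  have hz : fromBlocks P D Dᴴ Q *ᵥ Sum.elim u 0 = 0 := by
    rw [← h.dotProduct_mulVec_zero_iff, fromBlocks_mulVec]
    simp [dotProduct, Fintype.sum_sum_type] at h0 ⊢
    exact h0.symm
  rw [fromBlocks_mulVec] at hz
  have : Dᴴ *ᵥ u = 0 := by
    funext i
    simpa using congrFun hz (Sum.inr i)
  have hD' : IsUnit Dᴴ := hD.star
  exact (mulVec_injective_iff_isUnit.mpr hD') (by simpa using this)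

theorem PosSemidef.abs_weakLogMajorizedBy {ι : Type*} [Fintype ι] [DecidableEq ι]
    {B T : Matrix ι ι ℂ} (hB : B.PosSemidef) (h : (fromBlocks B T Tᴴ B).PosSemidef) :
    (CFC.abs T).WeakLogMajorizedBy B := by
  have hA : (CFC.abs T).PosSemidef := nonneg_iff_posSemidef.mp (CFC.abs_nonneg T)
  refine ⟨hA, hB, fun k _ hk => ?_⟩
  set R := ∏ j with j.val < k, hB.isHermitian.eigenvalues₀ j with hR
  have hR0 : 0 ≤ R := Finset.prod_nonneg fun j _ => hB.eigenvalues₀_nonneg j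
  rw [Fin.prod_filter_val_lt hk]
  set s : Fin k → ℝ := fun i => hA.isHermitian.eigenvalues₀ (Fin.castLE hk i) with hs
  -- A zero eigenvalue makes the left product vanish; otherwise `D` is invertible.
  by_cases hs0 : ∃ i, s i = 0
  · obtain ⟨i, hi⟩ := hs0
    exact (Finset.prod_eq_zero (Finset.mem_univ i) hi).le.trans hR0
  push Not at hs0
  obtain ⟨W, hW1, -, hW⟩ := hA.isHermitian.exists_unitary_eigenvalues₀
  set V : Matrix ι (Fin k) ℂ := W.submatrix id (Fin.castLE hk) with hVdef
  set D : Matrix (Fin k) (Fin k) ℂ := diagonal fun i => (s i : ℂ) with hDdef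
  set E : Matrix (Fin k) (Fin k) ℂ := diagonal fun i => ((s i)⁻¹ : ℂ) with hEdef
  have hDh : Dᴴ = D := by simp [D, diagonal_conjTranspose, Pi.star_def]
  have hEh : Eᴴ = E := by simp [E, diagonal_conjTranspose, Pi.star_def]
  have hED : E * D = 1 := by simp [E, D, hs0]
  have hDE : D * E = 1 := by simp [E, D, hs0]
  have hV : Vᴴ * V = 1 := by
    rw [hVdef, conjTranspose_submatrix, ← submatrix_mul _ _ _ _ _ Function.bijective_id, hW1,
      submatrix_one _ (Fin.castLE_injective hk)]
  have hAV : CFC.abs T * V = V * D := by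
    have h1 : CFC.abs T * W = W * diagonal (fun j => (hA.isHermitian.eigenvalues₀ j : ℂ)) := by
      conv_lhs => rw [hW]
      rw [Matrix.mul_assoc, hW1, Matrix.mul_one]
    ext a b
    have := congrFun (congrFun h1 a) (Fin.castLE hk b)
    rw [mul_diagonal] at this ⊢
    exact this
  have hTT : Vᴴ * (Tᴴ * T) * V = D * D := by
    have : Tᴴ * T = CFC.abs T * CFC.abs T := (CFC.abs_mul_abs T).symm
    rw [this, Matrix.mul_assoc, Matrix.mul_assoc, hAV, ← Matrix.mul_assoc (CFC.abs T), hAV,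
      Matrix.mul_assoc, ← Matrix.mul_assoc, hV, Matrix.one_mul]
  set X : Matrix ι (Fin k) ℂ := T * V * E with hXdef
  have hXT : Xᴴ * T * V = D := by
    calc Xᴴ * T * V = Eᴴ * (Vᴴ * (Tᴴ * T) * V) := by simp [X, Matrix.mul_assoc]
      _ = D := by rw [hTT, hEh, ← Matrix.mul_assoc, hED, Matrix.one_mul]
  have hX : Xᴴ * X = 1 := by
    calc Xᴴ * X = Xᴴ * T * V * E := by simp [X, Matrix.mul_assoc]
      _ = 1 := by rw [hXT, hDE]
  set P := Xᴴ * B * X with hP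
  have hblock : (fromBlocks P D Dᴴ (Vᴴ * B * V)).PosSemidef := by
    convert h.conjTranspose_mul_mul_same (fromBlocks X 0 0 V) using 1
    rw [fromBlocks_conjTranspose, fromBlocks_multiply, fromBlocks_multiply]
    simp only [conjTranspose_zero, Matrix.zero_mul, Matrix.mul_zero, add_zero, zero_add]
    rw [hXT, ← hP]
    congr 1
    rw [← hXT]
    simp [Matrix.mul_assoc]
  have hPpos : P.PosDef := hblock.posDef_of_fromBlocks ⟨⟨D, E, hDE, hED⟩, rfl⟩
  let := hPpos.isUnit.invertible
  have hschur := (PosDef.fromBlocks₁₁ D (Vᴴ * B * V) hPpos).mp hblock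
  have h1 := hPpos.posSemidef.det_le_prod_eigenvalues₀ hk hB.isHermitian hX
    (by rw [← hP, sub_self]; exact .zero)
  -- The Schur complement says that the compression of `B` by `V` dominates `D P⁻¹ D`.
  have h2 := (hPpos.inv.posSemidef.conjTranspose_mul_mul_same D).det_le_prod_eigenvalues₀ hk
    hB.isHermitian hV hschur
  rw [← hR] at h1 h2
  have hdet : P.det * (Dᴴ * P⁻¹ * D).det = ((∏ i, s i : ℝ) : ℂ) ^ 2 := by
    have hPd : P.det * P⁻¹.det = 1 := by
      rw [← det_mul, mul_nonsing_inv _ ((isUnit_iff_isUnit_det _).mp hPpos.isUnit), det_one]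
    have hDd : D.det = ((∏ i, s i : ℝ) : ℂ) := by simp [D]
    rw [det_mul, det_mul, hDh, ← hDd]
    linear_combination D.det ^ 2 * hPd
  have h3 : ((∏ i, s i : ℝ) : ℂ) ^ 2 ≤ (R : ℂ) ^ 2 := by
    rw [← hdet, sq (R : ℂ)]
    exact mul_le_mul h1 h2 (hPpos.inv.posSemidef.conjTranspose_mul_mul_same D).det_nonneg
      (Complex.zero_le_real.mpr hR0)
  exact abs_le_of_sq_le_sq' (by exact_mod_cast h3) hR0 |>.2


/-! ### Positivity of the block matrix -/

theorem posSemidef_fromBlocks_smul {ι : Type*} [Fintype ι] [DecidableEq ι] {A : Matrix ι ι ℂ}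
    (hA : A.PosSemidef) {z : ℂ} (hz : ‖z‖ = 1) :
    (fromBlocks A (z • A) (z • A)ᴴ A).PosSemidef := by
  have hzz : star z * z = 1 := by
    rw [RCLike.star_def, Complex.conj_mul', hz]
    simp
  convert hA.conjTranspose_mul_mul_same (fromCols (1 : Matrix ι ι ℂ) (z • (1 : Matrix ι ι ℂ))) using 1
  rw [conjTranspose_fromCols_eq_fromRows_conjTranspose, fromRows_mul, fromRows_mul_fromCols,
    conjTranspose_smul, hA.isHermitian.eq]
  simp only [conjTranspose_one, conjTranspose_smul, Matrix.one_mul, Matrix.mul_one,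
    Matrix.smul_mul, Matrix.mul_smul, smul_smul, hzz, one_smul, mul_comm z]

section

open scoped Matrix.Norms.L2Operator

variable {ι : Type*} [Fintype ι] [DecidableEq ι]

/-- The spectrum is finite, so every function on it is continuous and the indicators of its points
are available to the functional calculus. -/
theorem exists_spectral_projections_of_mem_unitary {U : Matrix ι ι ℂ}
    (hU : U ∈ unitary (Matrix ι ι ℂ)) :
    ∃ (s : Finset ℂ) (P : ℂ → Matrix ι ι ℂ), (∀ z ∈ s, ‖z‖ = 1) ∧ (∀ z, 0 ≤ P z) ∧
      ∑ z ∈ s, P z = 1 ∧ ∑ z ∈ s, z • P z = U := by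
  have hfin := U.finite_spectrum
  have hnormal : IsStarNormal U :=
    ⟨(Unitary.star_mul_self_of_mem hU).trans (Unitary.mul_star_self_of_mem hU).symm⟩
  have hcont : ∀ f : ℂ → ℂ, ContinuousOn f (spectrum ℂ U) := fun f => hfin.continuousOn f
  refine ⟨hfin.toFinset, fun z => cfc (Pi.single z (1 : ℂ) : ℂ → ℂ) U, fun z hz => ?_,
    fun z => cfc_nonneg fun x _ => ?_, ?_, ?_⟩
  · have := Unitary.spectrum_subset_circle (𝕜 := ℂ) ⟨U, hU⟩ (hfin.mem_toFinset.mp hz)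
    simpa using this
  · by_cases h : x = z <;> simp [h]
  · rw [← cfc_sum _ _ _ fun _ _ => hcont _, ← cfc_one ℂ U]
    refine cfc_congr fun x hx => ?_
    simp [Finset.sum_apply, Pi.single_apply, hfin.mem_toFinset.mpr hx]
  · have : ∀ z : ℂ, z • cfc (Pi.single z (1 : ℂ) : ℂ → ℂ) U =
        cfc (fun x => z * (Pi.single z (1 : ℂ) : ℂ → ℂ) x) U :=
      fun z => (cfc_const_mul z _ U (hcont _)).symm
    simp only [this]
    rw [← cfc_sum _ _ _ fun _ _ => hcont _]
    conv_rhs => rw [← cfc_id ℂ U]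
    refine cfc_congr fun x hx => ?_
    simp [Finset.sum_apply, Pi.single_apply, hfin.mem_toFinset.mpr hx]

/-- Polar decomposition `Z = W P`, where the contraction `P = |Z|` is the mean of the unitaries `P ±
i√(1 - P²)`. Invertibility makes `W = Z P⁻¹` available. -/
theorem exists_unitary_average_of_isUnit {Z : Matrix ι ι ℂ} (hZ : ‖Z‖ ≤ 1) (hu : IsUnit Z) :
    ∃ U ∈ unitary (Matrix ι ι ℂ), ∃ V ∈ unitary (Matrix ι ι ℂ),
      Z = (2⁻¹ : ℂ) • (U + V) := by
  set P := CFC.abs Z with hP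
  have hPP : P * P = star Z * Z := CFC.abs_mul_abs Z
  have hPs : IsSelfAdjoint P := (CFC.abs_nonneg Z).isSelfAdjoint
  have hPn : ‖P‖ ≤ 1 := by
    have h1 : ‖P‖ * ‖P‖ = ‖Z‖ * ‖Z‖ := by
      rw [← CStarRing.norm_star_mul_self (x := Z), ← hPP, ← CStarRing.norm_star_mul_self (x := P),
        hPs.star_eq]
    nlinarith [norm_nonneg P, norm_nonneg Z]
  have hPu : IsUnit P := by
    have : IsUnit (P * P) := hPP ▸ hu.star.mul hu
    exact isUnit_of_mul_isUnit_left this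
  have hPd : IsUnit P.det := (isUnit_iff_isUnit_det _).mp hPu
  have hW : Z * P⁻¹ ∈ unitary (Matrix ι ι ℂ) := by
    refine mem_unitaryGroup_iff'.mpr ?_
    have hPi : star P⁻¹ = P⁻¹ := by
      rw [star_eq_conjTranspose, conjTranspose_nonsing_inv, ← star_eq_conjTranspose, hPs.star_eq]
    calc star (Z * P⁻¹) * (Z * P⁻¹) = P⁻¹ * (star Z * Z) * P⁻¹ := by
          rw [star_mul, hPi]; simp only [Matrix.mul_assoc]
      _ = 1 := by
          rw [← hPP, ← Matrix.mul_assoc, nonsing_inv_mul _ hPd, Matrix.one_mul,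
            mul_nonsing_inv _ hPd]
  let a : selfAdjoint (Matrix ι ι ℂ) := ⟨P, hPs⟩
  let u := selfAdjoint.unitarySelfAddISMul a hPn
  refine ⟨_, mul_mem hW u.2, _, mul_mem hW (star u).2, ?_⟩
  have huu : (u : Matrix ι ι ℂ) + (star u : unitary (Matrix ι ι ℂ)) = (2 : ℂ) • P := by
    rw [Unitary.coe_star, selfAdjoint.star_coe_unitarySelfAddISMul a hPn,
      selfAdjoint.unitarySelfAddISMul_coe a hPn,
      add_add_sub_cancel, ← two_smul ℂ]
  rw [← mul_add, huu, mul_smul_comm, smul_smul, inv_mul_cancel₀ two_ne_zero, one_smul,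
    nonsing_inv_mul_cancel_right _ _ hPd]

end

variable {ι κ : Type*} [Fintype ι] [DecidableEq ι] [Fintype κ] [DecidableEq κ]

theorem posSemidef_fromBlocks_map_of_mem_unitary (Φ : Matrix ι ι ℂ →ₚ[ℂ] Matrix κ κ ℂ)
    {U : Matrix ι ι ℂ} (hU : U ∈ unitary (Matrix ι ι ℂ)) :
    (fromBlocks (Φ 1) (Φ U) (Φ U)ᴴ (Φ 1)).PosSemidef := by
  obtain ⟨s, P, hs, hP, h1, hU⟩ := exists_spectral_projections_of_mem_unitary hU
  have key : fromBlocks (Φ 1) (Φ U) (Φ U)ᴴ (Φ 1) =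
      ∑ z ∈ s, fromBlocks (Φ (P z)) (z • Φ (P z)) (z • Φ (P z))ᴴ (Φ (P z)) := by
    rw [← h1, ← hU, map_sum, map_sum]
    simp only [map_smul]
    ext (i | i) (j | j) <;> simp [sum_apply, conjTranspose_sum]
  rw [key]
  refine posSemidef_sum _ fun z hz => posSemidef_fromBlocks_smul ?_ (hs z hz)
  exact nonneg_iff_posSemidef.mp (map_nonneg Φ (hP z))

theorem posSemidef_fromBlocks_map_of_isUnit (Φ : Matrix ι ι ℂ →ₚ[ℂ] Matrix κ κ ℂ)
    {Z : Matrix ι ι ℂ} (hZ : Z.IsContraction) (hu : IsUnit Z) :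
    (fromBlocks (Φ 1) (Φ Z) (Φ Z)ᴴ (Φ 1)).PosSemidef := by
  obtain ⟨U, hU, V, hV, rfl⟩ := exists_unitary_average_of_isUnit hZ hu
  have h := ((posSemidef_fromBlocks_map_of_mem_unitary Φ hU).add
    (posSemidef_fromBlocks_map_of_mem_unitary Φ hV)).smul (a := (2⁻¹ : ℝ)) (by norm_num)
  convert h using 1
  rw [map_smul, map_add]
  ext (i | i) (j | j) <;> simp <;> ring

theorem posSemidef_fromBlocks_map (Φ : Matrix ι ι ℂ →ₚ[ℂ] Matrix κ κ ℂ)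
    {Z : Matrix ι ι ℂ} (hZ : Z.IsContraction) :
    (fromBlocks (Φ 1) (Φ Z) (Φ Z)ᴴ (Φ 1)).PosSemidef := by
  have hΦ : (Φ 1).PosSemidef := nonneg_iff_posSemidef.mp (map_nonneg Φ zero_le_one)
  set M := fromBlocks (Φ 1) (Φ Z) (Φ Z)ᴴ (Φ 1) with hM
  set N := fromBlocks (Φ 1) (Φ 1) (Φ 1)ᴴ (Φ 1) with hN
  -- `N` is the block for `Z = 1`, so `M + ε N` is `1 + ε` times the block of the contraction `(Z +
  -- ε)/(1 + ε)`.
  have hpert : ∀ ε : ℝ, 0 < ε → IsUnit (Z + (ε : ℂ) • 1) → (M + ε • N).PosSemidef := by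
    intro ε hε hu
    have hc : ((1 + ε : ℝ) : ℂ) ≠ 0 := by exact_mod_cast (by positivity : (1 + ε : ℝ) ≠ 0)
    have hcontr : (((1 + ε : ℝ) : ℂ)⁻¹ • (Z + (ε : ℂ) • 1)).IsContraction := by
      unfold IsContraction at hZ ⊢
      rw [map_smul, map_add, map_smul, map_one, norm_smul, norm_inv, Complex.norm_real,
        Real.norm_of_nonneg (by positivity)]
      rw [inv_mul_le_one₀ (by positivity)]
      refine (norm_add_le _ _).trans (add_le_add hZ ?_)
      rw [norm_smul, Complex.norm_real, Real.norm_of_nonneg hε.le]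
      exact mul_le_of_le_one_right hε.le ContinuousLinearMap.norm_id_le
    have h := posSemidef_fromBlocks_map_of_isUnit Φ hcontr
      (hu.smul (Units.mk0 _ (inv_ne_zero hc)))
    convert h.smul (a := 1 + ε) (by positivity) using 1
    rw [map_smul, map_add, map_smul, hM, hN]
    have hc' : (1 + ε : ℂ) ≠ 0 := by exact_mod_cast hc
    ext (i | i) (j | j) <;> simp <;> field_simp
  refine .of_dotProduct_mulVec_nonneg ?_ fun x => ?_
  · exact hΦ.isHermitian.fromBlocks rfl hΦ.isHermitian
  have hlim : Filter.Tendsto (fun ε : ℝ => star x ⬝ᵥ (M *ᵥ x) + ε • (star x ⬝ᵥ (N *ᵥ x)))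
      (nhdsWithin 0 (Set.Ioi 0)) (nhds (star x ⬝ᵥ (M *ᵥ x))) := by
    refine Filter.Tendsto.mono_left ?_ nhdsWithin_le_nhds
    have : Continuous fun ε : ℝ => star x ⬝ᵥ (M *ᵥ x) + ε • (star x ⬝ᵥ (N *ᵥ x)) := by fun_prop
    simpa using this.tendsto 0
  refine ge_of_tendsto hlim ?_
  -- Only finitely many `ε` make `Z + ε` singular, so `ε → 0⁺` can avoid them.
  have hfin : {ε : ℝ | -(ε : ℂ) ∈ spectrum ℂ Z}.Finite :=
    Z.finite_spectrum.preimage fun a _ b _ hab => by simpa using hab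
  have hev : ∀ᶠ ε : ℝ in nhdsWithin 0 (Set.Ioi 0), -(ε : ℂ) ∉ spectrum ℂ Z := by
    have hne : nhdsWithin (0 : ℝ) (Set.Ioi 0) ≤ nhdsWithin 0 {0}ᶜ :=
      nhdsWithin_mono _ fun _ h => (ne_of_gt h)
    exact (hne.trans (nhdsNE_le_cofinite 0)) hfin.eventually_cofinite_notMem
  filter_upwards [hev, self_mem_nhdsWithin] with ε h1 h2
  have hu : IsUnit (Z + (ε : ℂ) • 1) := by
    rw [spectrum.notMem_iff, Algebra.algebraMap_eq_smul_one, ← IsUnit.neg_iff] at h1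
    convert h1 using 1
    simp
  have := (hpert ε h2 hu).dotProduct_mulVec_nonneg x
  rwa [add_mulVec, smul_mulVec, dotProduct_add, dotProduct_smul] at this

end Matrix

theorem corollary3p2 (n m : ℕ) (Z : Matrix (Fin n) (Fin n) ℂ) (hZ : Z.IsContraction)
    (Φ : Matrix (Fin n) (Fin n) ℂ →ₚ[ℂ] Matrix (Fin m) (Fin m) ℂ) :
    (CFC.abs (Φ Z)).WeakLogMajorizedBy (Φ 1) := by
  exact (Matrix.nonneg_iff_posSemidef.mp (map_nonneg Φ zero_le_one)).abs_weakLogMajorizedBy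
    (Matrix.posSemidef_fromBlocks_map Φ hZ)
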